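/- Let $N=\mathbb Z^{n+1}/\mathbb Z\mathbf 1$ and work in the tropical projective torus $\mathbb{PT}^n=\mathbb R^{n+1}/\mathbb R\mathbf 1$ with the min-plus convention. For $U\subseteq\mathbb{PT}^n$ let $\operatorname{tconv}U$ be its tropical convex hull, that is, the set of classes of all vectors $\big(\min_{1\le i\le k}(a_i+u_{ij})\big)_{j=0,\dots,n}$ with $k\ge 1$, $a_i\in\mathbb R$ and $u_i\in\mathbb R^{n+1}$ with class in $U$; the dimension $\dim$ of a finite union of polyhedra is the largest dimension of a polyhedron contained in it. Let $\Gamma\subset\mathbb{PT}^n$ be a tropical curve (not necessarily a fan), i.e. a finite nonempty polyhedral complex of pure dimension one whose edges are segments and rays (a line being subdivided into two rays) with directions in $N$, with a positive integer multiplicity $m_\sigma$ on each edge $\sigma$, such that at each vertex the sum of the outgoing primitive vectors of $N$ along the edges, weighted by the multiplicities, is zero. Let $H$ be the standard tropical hyperplane, the set of classes of points $x\in\mathbb{R}^{n+1}$ for which $\min(x_0,\dots,x_n)$ is attained at least twice, with its maximal cones $\{x_a=x_b\le x_c\ \text{for all } c\}$, $a\neq b$, of multiplicity one. The degree $\deg\Gamma$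 is the degree of the stable intersection of $\Gamma$ and $H$, i.e. the sum over its finitely many points $p$ of the multiplicities $$\sum_{\sigma,\tau} m_\sigma\,[N:N_\sigma+N_\tau],$$ where $\sigma$ runs over the edges of $\Gamma$ containing $p$ and $\tau$ over the maximal cones of $H$ containing $p$ such that the cones $C_\sigma=\mathbb R_{\ge0}(\sigma-p)$ and $C_\tau=\mathbb R_{\ge0}(\tau-p)$ satisfy $C_\sigma\cap(v+C_\tau)\ne\emptyset$ for a fixed generic $v\in\mathbb{PT}^n$, and $N_\sigma$, $N_\tau$ are the sets of lattice points in the linear spaces parallel to $\sigma$, $\tau$. (If $\Gamma$ is a fan, $\deg\Gamma$ is the multiplicity of the stable intersection at the origin.) Let $r_1,\dots,r_k$ be the rays (unbounded edges) of $\Gamma$. If $$\dim\operatorname{tconv}\Gamma=\max_{1\le i\le k}\dim\operatorname{tconv}r_i,$$ then $\dim\operatorname{tconv}\Gamma\le\deg\Gamma$. -/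

import Mathlib

open scoped ENNReal

noncomputable section

namespace TropCurve

/-- The tropical projective torus `ℝ^{n+1} / ℝ𝟏`, with coordinates indexed by `0, …, n`. -/
abbrev PT (n : ℕ) : Type :=
  (Fin (n + 1) → ℝ) ⧸ Submodule.span ℝ {(1 : Fin (n + 1) → ℝ)}

/-- The quotient map `ℝ^{n+1} → ℝ^{n+1} / ℝ𝟏`. -/
def proj (n : ℕ) : (Fin (n + 1) → ℝ) →ₗ[ℝ] PT n :=
  Submodule.mkQ _

/-- The tropical convex hull (min-plus convention) of a subset of `ℝ^{n+1} / ℝ𝟏`: the classes of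
all tropical linear combinations `a₁ ⊙ u₁ ⊕ ⋯ ⊕ a_k ⊙ u_k`, `k ≥ 1`, of vectors `u_i` whose
classes lie in `U`. -/
def tconv {n : ℕ} (U : Set (PT n)) : Set (PT n) :=
  {y | ∃ (k : ℕ) (u : Fin (k + 1) → Fin (n + 1) → ℝ) (a : Fin (k + 1) → ℝ),
    (∀ i, proj n (u i) ∈ U) ∧
      y = proj n (fun j => Finset.univ.inf' Finset.univ_nonempty (fun i => a i + u i j))}

/-- A polyhedron: an intersection of finitely many closed halfspaces. -/
def IsPolyhedron {n : ℕ} (P : Set (PT n)) : Prop :=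
  ∃ s : Finset ((PT n →ₗ[ℝ] ℝ) × ℝ), P = {x | ∀ h ∈ s, h.2 ≤ h.1 x}

/-- The dimension of a polyhedral set (a finite union of polyhedra): the largest dimension of a
polyhedron contained in it, the dimension of a polyhedron being that of its affine hull. -/
def dim {n : ℕ} (S : Set (PT n)) : ℕ :=
  sSup {d | ∃ P : Set (PT n), IsPolyhedron P ∧ P ⊆ S ∧ d = Module.finrank ℝ (vectorSpan ℝ P)}

/-- A one-dimensional rational polyhedron with at least one vertex, i.e. a segment
(`length < ∞`) or a ray (`length = ∞`) starting at `base`. Its direction is given by the minimal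
nonnegative integer representative of a primitive vector of `ℤ^{n+1} / ℤ𝟏`: the entries are
nonnegative, one of them is zero, and their greatest common divisor is one. -/
structure Edge (n : ℕ) where
  base : PT n
  dir : Fin (n + 1) → ℕ
  length : ℝ≥0∞
  dir_min : ∃ i, dir i = 0
  dir_primitive : Finset.univ.gcd dir = 1
  length_ne_zero : length ≠ 0

namespace Edge

variable {n : ℕ}

/-- The direction, as a vector of `ℝ^{n+1} / ℝ𝟏`. -/
def vec (e : Edge n) : PT n :=
  proj n (fun i => (e.dir i : ℝ))

/-- The set of points of the edge. -/
def carrier (e : Edge n) : Set (PT n) :=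
  {x | ∃ t : ℝ, 0 ≤ t ∧ ENNReal.ofReal t ≤ e.length ∧ x = e.base + t • e.vec}

/-- `p` is the second endpoint of the (bounded) edge. -/
def IsEnd (e : Edge n) (p : PT n) : Prop :=
  e.length ≠ ∞ ∧ p = e.base + e.length.toReal • e.vec

/-- The vertices of the edge: two for a segment, one for a ray. -/
def endpoints (e : Edge n) : Set (PT n) :=
  {p | p = e.base ∨ e.IsEnd p}

end Edge

open Classical in
/-- A tropical curve in `ℝ^{n+1} / ℝ𝟏`: a finite rational polyhedral complex of pure dimension one,
given by its edges, with a positive integer multiplicity on each edge, balanced at each vertex.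
(An unbounded line is subdivided into two rays.) -/
structure TropicalCurve (n : ℕ) where
  numEdges : ℕ
  numEdges_pos : 0 < numEdges
  edge : Fin numEdges → Edge n
  mult : Fin numEdges → ℕ
  mult_pos : ∀ i, 0 < mult i
  /-- distinct edges meet, if at all, in a common vertex -/
  inter : ∀ i j, i ≠ j →
    (edge i).carrier ∩ (edge j).carrier ⊆ (edge i).endpoints ∩ (edge j).endpoints
  /-- at every vertex `p` the outgoing primitive vectors, weighted by the multiplicities,
  sum to zero -/
  balanced : ∀ p : PT n,
    (∑ i, if (edge i).base = p then mult i • (edge i).vec else 0) +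
      (∑ i, if (edge i).IsEnd p then mult i • (-(edge i).vec) else 0) = 0

/-- The lattice `ℤ^{n+1} / ℤ𝟏` in `ℝ^{n+1} / ℝ𝟏`. -/
def lattice (n : ℕ) : AddSubgroup (PT n) where
  carrier := {x | ∃ z : Fin (n + 1) → ℤ, x = proj n (fun i => (z i : ℝ))}
  zero_mem' := ⟨0, by
    have h : (fun i => (((0 : Fin (n + 1) → ℤ) i : ℤ) : ℝ)) = 0 := by ext; simp
    rw [h, map_zero]⟩
  add_mem' := by
    rintro _ _ ⟨z, rfl⟩ ⟨w, rfl⟩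
    refine ⟨z + w, ?_⟩
    rw [← map_add]
    congr 1
    ext i
    simp
  neg_mem' := by
    rintro _ ⟨z, rfl⟩
    refine ⟨-z, ?_⟩
    rw [← map_neg]
    congr 1
    ext i
    simp

/-- `N_σ`: the lattice points in the linear space parallel to the affine hull of `σ`. -/
def latticeOf {n : ℕ} (σ : Set (PT n)) : AddSubgroup (PT n) :=
  lattice n ⊓ (vectorSpan ℝ σ).toAddSubgroup

/-- The lattice index `[N : N_σ + N_τ]` (zero if infinite). -/
def latticeIndex {n : ℕ} (σ τ : Set (PT n)) : ℕ :=
  (latticeOf σ ⊔ latticeOf τ).relIndex (lattice n)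

/-- The cones of the standard tropical hyperplane, the tropicalization of `V(x₀ + ⋯ + x_n)` in the
min convention: for `#I ≥ 2`, the set where the minimum of the coordinates is attained at all
indices in `I`. The maximal cones, all of multiplicity one, are those with `#I = 2`. -/
def hypCone {n : ℕ} (I : Finset (Fin (n + 1))) : Set (PT n) :=
  proj n '' {x | ∀ a ∈ I, ∀ c, x a ≤ x c}

/-- The cone of the star at the point `p` that is generated by the polyhedron `σ ∋ p`. -/
def coneAt {n : ℕ} (σ : Set (PT n)) (p : PT n) : Set (PT n) :=
  {y | ∃ t : ℝ, 0 ≤ t ∧ ∃ x ∈ σ, y = t • (x - p)}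

namespace TropicalCurve

variable {n : ℕ}

/-- The curve as a subset of `ℝ^{n+1} / ℝ𝟏`. -/
def support (Γ : TropicalCurve n) : Set (PT n) :=
  ⋃ i, (Γ.edge i).carrier

/-- The rays of the curve: its unbounded edges. -/
def rays (Γ : TropicalCurve n) : Set (Set (PT n)) :=
  {r | ∃ i, (Γ.edge i).length = ∞ ∧ r = (Γ.edge i).carrier}

/-- The linear space spanned by the directions of a cell of the curve (a vertex for `none`, an edge
for `some i`) and of a cone of the standard tropical hyperplane. -/
def cellSum (Γ : TropicalCurve n) (c : Option (Fin Γ.numEdges) × Finset (Fin (n + 1))) :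
    Submodule ℝ (PT n) :=
  (match c.1 with
    | none => ⊥
    | some i => Submodule.span ℝ {(Γ.edge i).vec}) ⊔ Submodule.span ℝ (hypCone c.2)

/-- A displacement vector is generic if it avoids the sum of the linear spaces of a cell of the
curve and of a cone of the standard tropical hyperplane whenever that sum is not everything. -/
def IsGeneric (Γ : TropicalCurve n) (v : PT n) : Prop :=
  ∀ c : Option (Fin Γ.numEdges) × Finset (Fin (n + 1)),
    2 ≤ c.2.card → Γ.cellSum c ≠ ⊤ → v ∉ Γ.cellSum c

theorem exists_isGeneric (Γ : TropicalCurve n) : ∃ v, Γ.IsGeneric v := by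
  classical
  let S : Finset (Submodule ℝ (PT n)) :=
    (Finset.univ.image Γ.cellSum).filter (fun L => L ≠ ⊤)
  have hS : (⋃ L ∈ S, (L : Set (PT n))) ≠ Set.univ := by
    refine Subspace.biUnion_ne_univ_of_top_notMem ?_
    simp [S]
  obtain ⟨v, hv⟩ := (Set.ne_univ_iff_exists_notMem _).1 hS
  refine ⟨v, fun c _ hc hvc => hv ?_⟩
  refine Set.mem_biUnion (x := Γ.cellSum c) ?_ hvc
  simp [S, hc]

/-- A fixed generic displacement vector. -/
def genericVector (Γ : TropicalCurve n) : PT n :=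
  Γ.exists_isGeneric.choose

open Classical in
/-- The multiplicity of the point `p` in the stable intersection of the curve with the standard
tropical hyperplane, computed with the displacement `v`: the sum of `mult(σ) [N : N_σ + N_τ]` over
the edges `σ` of the curve and the maximal cones `τ` of the hyperplane that contain `p` and whose
cones in the stars at `p` still meet after the second one is displaced by `v`. -/
def multAt (Γ : TropicalCurve n) (v p : PT n) : ℕ :=
  ∑ i : Fin Γ.numEdges, ∑ I ∈ (Finset.univ : Finset (Fin (n + 1))).powersetCard 2,
    if p ∈ (Γ.edge i).carrier ∧ p ∈ hypCone I ∧
        (∃ y ∈ coneAt (Γ.edge i).carrier p, ∃ z ∈ coneAt (hypCone I) p, y = v + z)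
    then Γ.mult i * latticeIndex (Γ.edge i).carrier (hypCone I) else 0

/-- The multiplicity of the point `p` in the stable intersection of the curve with the standard
tropical hyperplane (zero if `p` does not belong to the stable intersection). -/
def stableMult (Γ : TropicalCurve n) (p : PT n) : ℕ :=
  Γ.multAt Γ.genericVector p

/-- The degree of a tropical curve: the degree of its stable intersection with the standard tropical
hyperplane, i.e. the sum of the multiplicities of the finitely many points of the stable
intersection. If the curve is a fan, this is the multiplicity at the origin. -/
def degree (Γ : TropicalCurve n) : ℕ :=
  ∑ᶠ p, Γ.stableMult p

end TropicalCurve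

end TropCurve

end

/-! Both sides are compared with the entries of the primitive direction `w` of a ray, normalised to
be nonnegative integers with minimum zero.

Upper bound for the hull (`Edge.dim_tconv_carrier_le`): a tropical combination of points `B + s_i w`
equals, modulo the all-ones vector, `B + g(w_j)` for a single function `g` of the slope. If all
entries of `w` lie in `{0, …, M}`, only the values `g(1) - g(0), …, g(M) - g(0)` matter, so the
dimension is at most `M`. By hypothesis some ray realises the dimension of the whole hull, so it
remains to bound its entries by the degree.

Lower bound for the degree (`sum_rays_le_degree`): for every coordinate `c`, the degree is at least
the sum of `m_r w_c` over the rays `r`. Consider `min_j x_j - x_c` on the curve. Minus the sum of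
its outgoing slopes at a point `p`, weighted by multiplicity, is the sum of the `slopeDrop` terms;
by balancing it does not depend on `c`. Displacing the hyperplane generically turns it into slope
drops of lower envelopes of affine functions. Each break of such an envelope comes from two
coordinates that are minimal together, that is, from a maximal cone met by the displaced edge, and
its size is at most a lattice index. Hence the stable multiplicity at `p` dominates this sum. Summed
over all points, the slopes telescope along each edge: bounded edges contribute at least zero, and a
ray at least `w_c`, since far out on it the minimum has slope zero. -/

namespace TropCurve

/-! ### Lower envelopes of finitely many affine functions -/

section Envelope

variable {ι κ : Type*}

/-- Among the affine functions `s ↦ b e + s * w e`, `e ∈ J`, the one with index `c` is minimal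
at `s`. -/
def IsLow (J : Finset ι) (b w : ι → ℝ) (s : ℝ) (c : ι) : Prop :=
  c ∈ J ∧ ∀ e ∈ J, b c + s * w c ≤ b e + s * w e

theorem IsLow.exists_min_slope {J : Finset ι} {b w : ι → ℝ} {s : ℝ} {c : ι}
    (h : IsLow J b w s c) :
    ∃ d, IsLow J b w s d ∧ ∀ e, IsLow J b w s e → w d ≤ w e := by
  classical
  obtain ⟨d, hd, hmin⟩ := (J.filter (IsLow J b w s)).exists_min_image w
    ⟨c, Finset.mem_filter.2 ⟨h.1, h⟩⟩
  exact ⟨d, (Finset.mem_filter.1 hd).2, fun e he => hmin e (Finset.mem_filter.2 ⟨he.1, he⟩)⟩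

theorem exists_isLow {J : Finset ι} (hJ : J.Nonempty) (b w : ι → ℝ) (s : ℝ) :
    ∃ c, IsLow J b w s c := by
  obtain ⟨c, hc, h⟩ := J.exists_min_image (fun e => b e + s * w e) hJ
  exact ⟨c, hc, h⟩

/-- If the lowest function of smallest slope at `s` is not of smallest slope overall, there is a
next breakpoint of the lower envelope. -/
theorem IsLow.exists_next {J : Finset ι} {b w : ι → ℝ} {s : ℝ} {c d : ι}
    (hc : IsLow J b w s c) (hmin : ∀ e, IsLow J b w s e → w c ≤ w e)
    (hd : d ∈ J) (hdc : w d < w c) :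
    ∃ t c', s < t ∧ IsLow J b w t c ∧ IsLow J b w t c' ∧ w c' < w c ∧
      ∀ e, IsLow J b w t e → w c' ≤ w e := by
  classical
  -- Among the functions of smaller slope, `a` is the first to cross the line of `c`. A crossing at
  -- or before `s` would make `a` lowest at `s`, against the choice of `c`.
  obtain ⟨a, ha, hle⟩ := (J.filter (fun e => w e < w c)).exists_min_image
    (fun e => (b e - b c) / (w c - w e)) ⟨d, Finset.mem_filter.2 ⟨hd, hdc⟩⟩
  obtain ⟨haJ, hac⟩ := Finset.mem_filter.1 ha
  set t := (b a - b c) / (w c - w a) with ht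
  have hpos : 0 < w c - w a := sub_pos.2 hac
  have hta : t * (w c - w a) = b a - b c := div_mul_cancel₀ _ hpos.ne'
  have hst : s < t := by
    rw [ht, lt_div_iff₀ hpos]
    by_contra! hcon
    have : IsLow J b w s a := ⟨haJ, fun e he => by linarith [hc.2 e he]⟩
    linarith [hmin a this]
  have hct : IsLow J b w t c := by
    refine ⟨hc.1, fun e he => ?_⟩
    rcases lt_or_ge (w e) (w c) with h | h
    · have h1 := hle e (Finset.mem_filter.2 ⟨he, h⟩)
      rw [le_div_iff₀ (sub_pos.2 h)] at h1
      linarith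
    · have h1 := hc.2 e he
      nlinarith
  have hat : IsLow J b w t a := ⟨haJ, fun e he => by linarith [hct.2 e he]⟩
  -- Several functions may cross at `t`; the one of smallest slope is lowest just after it.
  obtain ⟨c', hc', hmin'⟩ := hat.exists_min_slope
  exact ⟨t, c', hst, hct, hc', (hmin' a hat).trans_lt hac, hmin'⟩

theorem IsLow.of_between {J : Finset ι} {b w : ι → ℝ} {s t u : ℝ} {c : ι}
    (hs : IsLow J b w s c) (hu : IsLow J b w u c) (h1 : s ≤ t) (h2 : t ≤ u) :
    IsLow J b w t c := by
  refine ⟨hs.1, fun e he => ?_⟩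
  have hs' := hs.2 e he
  have hu' := hu.2 e he
  rcases le_total (w e) (w c) with h | h <;> nlinarith

open Classical in
/-- The slope drop of a lower envelope between `s` and `S` is bounded by the total weight of a
family of events which accounts for each breakpoint by an event happening only there. -/
theorem slope_drop_le_sum {J : Finset ι} {b w : ι → ℝ} {S : ℝ} (E : Finset κ) (ω : κ → ℝ)
    (R : κ → ℝ → Prop) (hω : ∀ x ∈ E, 0 ≤ ω x)
    {d : ι} (hd : IsLow J b w S d) (hmax : ∀ e, IsLow J b w S e → w e ≤ w d)
    {s : ℝ} {c : ι} (hsS : s < S) (hc : IsLow J b w s c)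
    (hmin : ∀ e, IsLow J b w s e → w c ≤ w e)
    (hR : ∀ t c₀ c₁, s < t → t < S → IsLow J b w t c₀ → IsLow J b w t c₁ → w c₁ < w c₀ →
      ∃ x ∈ E, R x t ∧ (∀ t', R x t' → t' = t) ∧ w c₀ - w c₁ ≤ ω x) :
    w c - w d ≤ ∑ x ∈ E, if ∃ t, s < t ∧ t < S ∧ R x t then ω x else 0 := by
  induction hk : (J.filter (fun e => w e < w c)).card using Nat.strong_induction_on
    generalizing s c with
  | _ k ih =>
  have hnonneg : ∀ (r : ℝ), ∀ x ∈ E, 0 ≤ if ∃ t, r < t ∧ t < S ∧ R x t then ω x else 0 := by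
    intro r x hx
    split_ifs
    exacts [hω x hx, le_rfl]
  rcases le_or_gt (w c) (w d) with h | h
  · exact (sub_nonpos.2 h).trans (Finset.sum_nonneg (hnonneg s))
  obtain ⟨t, c', hst, hct, hct', hlt, hmin'⟩ := hc.exists_next hmin hd.1 h
  have htS : t < S := by
    by_contra! hcon
    exact (hmax c (hc.of_between hct hsS.le hcon)).not_gt h
  have hcard : (J.filter (fun e => w e < w c')).card < k := by
    rw [← hk]
    refine Finset.card_lt_card (Finset.ssubset_iff_of_subset ?_ |>.2 ⟨c', ?_, ?_⟩)
    · intro e he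
      rw [Finset.mem_filter] at he ⊢
      exact ⟨he.1, he.2.trans hlt⟩
    · exact Finset.mem_filter.2 ⟨hct'.1, hlt⟩
    · simp
  have hrec := ih _ hcard htS hct' hmin'
    (fun t' c₀ c₁ h1 => hR t' c₀ c₁ (hst.trans h1)) rfl
  obtain ⟨x, hx, hxt, huniq, hxω⟩ := hR t c c' hst htS hct hct' hlt
  rw [← Finset.add_sum_erase E _ hx] at hrec ⊢
  -- The event `x` happens only at `t`, so the recursive bound, which starts strictly after `t`, has
  -- not used it; it pays for the drop at `t`.
  have e1 : ¬ ∃ t', t < t' ∧ t' < S ∧ R x t' := by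
    rintro ⟨t', h1, -, h3⟩
    exact h1.ne' (huniq t' h3)
  have e2 : ∃ t', s < t' ∧ t' < S ∧ R x t' := ⟨t, hst, htS, hxt⟩
  rw [if_neg e1] at hrec
  rw [if_pos e2]
  have hmono : ∑ y ∈ E.erase x, (if ∃ t', t < t' ∧ t' < S ∧ R y t' then ω y else 0) ≤
      ∑ y ∈ E.erase x, (if ∃ t', s < t' ∧ t' < S ∧ R y t' then ω y else 0) := by
    refine Finset.sum_le_sum fun y hy => ?_
    by_cases h1 : ∃ t', t < t' ∧ t' < S ∧ R y t'
    · have h2 : ∃ t', s < t' ∧ t' < S ∧ R y t' := by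
        obtain ⟨t', h1, h2⟩ := h1
        exact ⟨t', hst.trans h1, h2⟩
      rw [if_pos h1, if_pos h2]
    · rw [if_neg h1]
      exact hnonneg s y (Finset.mem_of_mem_erase hy)
  linarith

/-- Sufficiently far to the right, the lowest functions are those of smallest slope. -/
theorem exists_isLow_right (J : Finset ι) (b w : ι → ℝ) (r : ℝ) :
    ∃ S > r, ∀ d, IsLow J b w S d → ∀ e ∈ J, w d ≤ w e := by
  have key : ∀ d ∈ J, ∀ e ∈ J, ∀ᶠ S : ℝ in Filter.atTop,
      b d + S * w d ≤ b e + S * w e → w d ≤ w e := by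
    intro d _ e _
    filter_upwards [Filter.eventually_gt_atTop ((b e - b d) / (w d - w e))] with S hS hle
    by_contra! hlt
    rw [div_lt_iff₀ (sub_pos.2 hlt)] at hS
    linarith
  have h2 : ∀ᶠ S : ℝ in Filter.atTop, ∀ d ∈ J, ∀ e ∈ J,
      b d + S * w d ≤ b e + S * w e → w d ≤ w e := by
    rw [Filter.eventually_all_finset]
    intro d hd
    rw [Filter.eventually_all_finset]
    exact key d hd
  obtain ⟨S, hS, h⟩ := ((Filter.eventually_gt_atTop r).and h2).exists
  exact ⟨S, hS, fun d hd e he => h d hd.1 e he (hd.2 e he)⟩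

/-- Sufficiently far to the left, the lowest functions are those of largest slope. -/
theorem exists_isLow_left (J : Finset ι) (b w : ι → ℝ) (r : ℝ) :
    ∃ S < r, ∀ d, IsLow J b w S d → ∀ e ∈ J, w e ≤ w d := by
  obtain ⟨S, hS, h⟩ := exists_isLow_right J b (-w) (-r)
  refine ⟨-S, by linarith, fun d hd e he => ?_⟩
  have := h d ⟨hd.1, fun e he => by simpa using hd.2 e he⟩ e he
  simpa using this

open Classical in
/-- The slope drop of a lower envelope is bounded by the sum, over the pairs of functions which
are simultaneously lowest somewhere, of the slope differences. -/
theorem slope_drop_le_sum_pairs [Fintype ι] [DecidableEq ι] {J : Finset ι} {b w : ι → ℝ} {s S : ℝ}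
    {ω : Finset ι → ℝ} (hω : ∀ I, 0 ≤ ω I) (hωw : ∀ a c, a ≠ c → w c - w a ≤ ω {a, c})
    {C : Finset ι → Prop}
    (hC : ∀ t, s < t → t < S → ∀ a c, a ≠ c → IsLow J b w t a → IsLow J b w t c → C {a, c})
    {c d : ι} (hsS : s < S) (hc : IsLow J b w s c) (hmin : ∀ e, IsLow J b w s e → w c ≤ w e)
    (hd : IsLow J b w S d) (hmax : ∀ e, IsLow J b w S e → w e ≤ w d) :
    w c - w d ≤ ∑ I ∈ (Finset.univ : Finset ι).powersetCard 2, if C I then ω I else 0 := by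
  have hR : ∀ t c₀ c₁, s < t → t < S → IsLow J b w t c₀ → IsLow J b w t c₁ → w c₁ < w c₀ →
      ∃ I ∈ (Finset.univ : Finset ι).powersetCard 2,
        ((∀ a ∈ I, IsLow J b w t a) ∧ ∃ a ∈ I, ∃ e ∈ I, w a ≠ w e) ∧
        (∀ t', ((∀ a ∈ I, IsLow J b w t' a) ∧ ∃ a ∈ I, ∃ e ∈ I, w a ≠ w e) → t' = t) ∧
        w c₀ - w c₁ ≤ ω I := by
    intro t c₀ c₁ _ _ h0 h1 hlt
    have hne : c₁ ≠ c₀ := fun h => by simp [h] at hlt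
    refine ⟨{c₁, c₀}, ?_, ⟨?_, c₀, by simp, c₁, by simp, hlt.ne'⟩, ?_, hωw c₁ c₀ hne⟩
    · simp [Finset.mem_powersetCard, Finset.card_pair hne]
    · simp [h0, h1]
    · rintro t' ⟨h', -⟩
      have h0' := h' c₀ (by simp)
      have h1' := h' c₁ (by simp)
      have e1 := le_antisymm (h0.2 _ h1.1) (h1.2 _ h0.1)
      have e2 := le_antisymm (h0'.2 _ h1.1) (h1'.2 _ h0.1)
      -- Two affine functions of different slopes agree at one parameter only, so a pair accounts
      -- for a single breakpoint.
      have : (t' - t) * (w c₀ - w c₁) = 0 := by linarith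
      rcases mul_eq_zero.1 this with h | h
      · linarith
      · linarith
  refine (slope_drop_le_sum _ ω
    (fun I t => (∀ a ∈ I, IsLow J b w t a) ∧ ∃ a ∈ I, ∃ e ∈ I, w a ≠ w e)
    (fun I _ => hω I) hd hmax hsS hc hmin hR).trans (Finset.sum_le_sum fun I hI => ?_)
  by_cases h : ∃ t, s < t ∧ t < S ∧ (∀ a ∈ I, IsLow J b w t a) ∧ ∃ a ∈ I, ∃ e ∈ I, w a ≠ w e
  · obtain ⟨t, h1, h2, h3, -⟩ := id h
    obtain ⟨a, c', hne, rfl⟩ := Finset.card_eq_two.1 (Finset.mem_powersetCard.1 hI).2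
    rw [if_pos h, if_pos (hC t h1 h2 a c' hne (h3 _ (by simp)) (h3 _ (by simp)))]
  · rw [if_neg h]
    split_ifs
    exacts [hω I, le_rfl]

end Envelope

/-! ### Coordinate differences and the standard tropical hyperplane -/

section Coordinates

variable {n : ℕ}

/-- The linear functional `x ↦ x_a - x_c` on `ℝ^{n+1} / ℝ𝟏`. -/
noncomputable def coordDiff (a c : Fin (n + 1)) : PT n →ₗ[ℝ] ℝ :=
  Submodule.liftQ _ (LinearMap.proj (R := ℝ) (φ := fun _ => ℝ) a -
    LinearMap.proj (R := ℝ) (φ := fun _ => ℝ) c) (by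
    rw [Submodule.span_singleton_le_iff_mem, LinearMap.mem_ker]
    simp)

@[simp]
theorem coordDiff_proj (a c : Fin (n + 1)) (x : Fin (n + 1) → ℝ) :
    coordDiff a c (proj n x) = x a - x c := by
  simp [coordDiff, proj]

theorem proj_surjective : Function.Surjective (proj n) :=
  Submodule.mkQ_surjective _

theorem proj_eq_proj_iff {x y : Fin (n + 1) → ℝ} :
    proj n x = proj n y ↔ ∃ r : ℝ, ∀ j, x j = y j + r := by
  rw [proj, Submodule.mkQ_apply, Submodule.mkQ_apply, Submodule.Quotient.eq,
    Submodule.mem_span_singleton]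
  refine exists_congr fun r => ⟨fun h j => ?_, fun h => ?_⟩
  · have := congrFun h j
    simp at this
    linarith
  · ext j
    simp [h j]

theorem mem_hypCone_iff {I : Finset (Fin (n + 1))} {x : PT n} :
    x ∈ hypCone I ↔ ∀ a ∈ I, ∀ c, coordDiff a c x ≤ 0 := by
  constructor
  · rintro ⟨x, hx, rfl⟩ a ha c
    simpa using hx a ha c
  · intro h
    obtain ⟨x, rfl⟩ := proj_surjective x
    exact ⟨x, fun a ha c => by simpa using h a ha c, rfl⟩

/-- The indices at which the coordinates of `p` are minimal. -/
noncomputable def minSet (p : PT n) : Finset (Fin (n + 1)) :=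
  Finset.univ.filter (fun a => ∀ c, coordDiff a c p ≤ 0)

theorem mem_minSet_iff {p : PT n} {a : Fin (n + 1)} :
    a ∈ minSet p ↔ ∀ c, coordDiff a c p ≤ 0 := by
  simp [minSet]

theorem mem_minSet_proj_iff {x : Fin (n + 1) → ℝ} {a : Fin (n + 1)} :
    a ∈ minSet (proj n x) ↔ ∀ c, x a ≤ x c := by
  simp [mem_minSet_iff]

theorem minSet_nonempty (p : PT n) : (minSet p).Nonempty := by
  obtain ⟨x, rfl⟩ := proj_surjective p
  obtain ⟨a, -, h⟩ := Finset.univ.exists_min_image x Finset.univ_nonempty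
  exact ⟨a, mem_minSet_proj_iff.2 fun c => h c (Finset.mem_univ c)⟩

theorem mem_hypCone_iff_subset {I : Finset (Fin (n + 1))} {x : PT n} :
    x ∈ hypCone I ↔ I ⊆ minSet x := by
  simp [mem_hypCone_iff, Finset.subset_iff, mem_minSet_iff]

/-- Raising all coordinates other than `a` and `c` by `x a - min x` makes these two minimal. This
identifies the linear span of a maximal cone with the kernel of `coordDiff a c`. -/
theorem exists_sub_mem_hypCone {a c : Fin (n + 1)} {x : PT n} (hx : coordDiff a c x = 0) :
    ∃ y ∈ hypCone {a, c}, ∃ z ∈ hypCone {a, c}, x = y - z := by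
  obtain ⟨x, rfl⟩ := proj_surjective x
  obtain ⟨m, -, hm⟩ := Finset.univ.exists_min_image x Finset.univ_nonempty
  have hac : x a = x c := sub_eq_zero.1 (by simpa using hx)
  have hma := hm a (Finset.mem_univ a)
  let z : Fin (n + 1) → ℝ := fun j => if j = a ∨ j = c then 0 else x a - x m
  have hza : z a = 0 := by simp [z]
  have hzc : z c = 0 := by simp [z]
  have hz : ∀ j, 0 ≤ z j := by
    intro j
    simp only [z]
    split_ifs
    · exact le_rfl
    · linarith
  refine ⟨proj n (x + z), ?_, proj n z, ?_, by simp⟩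
  · have key : ∀ j, x a ≤ x j + z j := by
      intro j
      by_cases hj : j = a ∨ j = c
      · rcases hj with rfl | rfl
        · simp [hza]
        · simp [hzc, hac]
      · have := hm j (Finset.mem_univ j)
        simp only [z, if_neg hj]
        linarith
    rw [mem_hypCone_iff_subset]
    intro i hi
    rw [mem_minSet_proj_iff]
    intro j
    rcases Finset.mem_insert.1 hi with rfl | hi
    · simpa [hza] using key j
    · obtain rfl := Finset.mem_singleton.1 hi
      simpa [hzc, ← hac] using key j
  · rw [mem_hypCone_iff_subset]
    intro i hi
    rw [mem_minSet_proj_iff]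
    intro j
    rcases Finset.mem_insert.1 hi with rfl | hi
    · simpa [hza] using hz j
    · obtain rfl := Finset.mem_singleton.1 hi
      simpa [hzc] using hz j

theorem coordDiff_eq_zero_of_mem_hypCone {a c : Fin (n + 1)} {x : PT n}
    (hx : x ∈ hypCone {a, c}) : coordDiff a c x = 0 := by
  rw [mem_hypCone_iff] at hx
  have h1 := hx a (by simp) c
  have h2 := hx c (by simp) a
  obtain ⟨x, rfl⟩ := proj_surjective x
  simp only [coordDiff_proj] at *
  linarith

theorem span_hypCone_pair (a c : Fin (n + 1)) :
    Submodule.span ℝ (hypCone {a, c}) = (coordDiff a c).ker := by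
  refine le_antisymm (Submodule.span_le.2 fun x hx => coordDiff_eq_zero_of_mem_hypCone hx) ?_
  intro x hx
  obtain ⟨y, hy, z, hz, rfl⟩ := exists_sub_mem_hypCone hx
  exact sub_mem (Submodule.subset_span hy) (Submodule.subset_span hz)

theorem vectorSpan_hypCone_pair (a c : Fin (n + 1)) :
    vectorSpan ℝ (hypCone {a, c}) = (coordDiff a c).ker := by
  refine le_antisymm (Submodule.span_le.2 ?_) ?_
  · rintro _ ⟨y, hy, z, hz, rfl⟩
    simp [coordDiff_eq_zero_of_mem_hypCone hy, coordDiff_eq_zero_of_mem_hypCone hz]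
  · intro x hx
    obtain ⟨y, hy, z, hz, rfl⟩ := exists_sub_mem_hypCone hx
    exact vsub_mem_vectorSpan ℝ hy hz

theorem coordDiff_single {a c : Fin (n + 1)} (hac : a ≠ c) :
    coordDiff a c (proj n (Pi.single a 1)) = 1 := by
  simp [hac.symm]

theorem TropicalCurve.IsGeneric.coordDiff_ne_zero {Γ : TropicalCurve n} {v : PT n}
    (hv : Γ.IsGeneric v) {a c : Fin (n + 1)} (hac : a ≠ c) : coordDiff a c v ≠ 0 := by
  have hsum : Γ.cellSum (none, {a, c}) = (coordDiff a c).ker := by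
    simp [TropicalCurve.cellSum, span_hypCone_pair]
  have := hv (none, {a, c}) (Finset.card_pair hac).ge
  rw [hsum] at this
  refine fun h => this (fun htop => ?_) h
  have h1 : proj n (Pi.single a 1) ∈ (coordDiff a c).ker := htop ▸ Submodule.mem_top
  rw [LinearMap.mem_ker, coordDiff_single hac] at h1
  exact one_ne_zero h1

/-- Membership in the star cone of a maximal cone of the hyperplane only involves the coordinates
which are minimal at the base point. -/
theorem mem_coneAt_hypCone {I : Finset (Fin (n + 1))} {p y : PT n} (hp : p ∈ hypCone I)
    (hy : ∀ a ∈ I, ∀ c ∈ minSet p, coordDiff a c y ≤ 0) : y ∈ coneAt (hypCone I) p := by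
  -- For large `t` the point `t • p + y` lies in the cone: at an index outside `minSet p` the
  -- strictly negative term `t * coordDiff a c p` dominates.
  have key : ∀ a ∈ I, ∀ c, ∀ᶠ t : ℝ in Filter.atTop,
      t * coordDiff a c p + coordDiff a c y ≤ 0 := by
    intro a ha c
    have hap := mem_hypCone_iff.1 hp a ha c
    by_cases hc : c ∈ minSet p
    · filter_upwards [Filter.eventually_ge_atTop 0] with t ht
      have := hy a ha c hc
      nlinarith
    · have hlt : coordDiff a c p < 0 := by
        refine lt_of_le_of_ne hap fun h0 => hc ?_
        have ha' := mem_hypCone_iff_subset.1 hp ha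
        obtain ⟨x, rfl⟩ := proj_surjective p
        rw [mem_minSet_proj_iff] at ha' ⊢
        rw [coordDiff_proj, sub_eq_zero] at h0
        exact h0 ▸ ha'
      filter_upwards [Filter.eventually_ge_atTop (coordDiff a c y / -coordDiff a c p)] with t ht
      rw [div_le_iff₀ (neg_pos.2 hlt)] at ht
      linarith
  have h2 : ∀ᶠ t : ℝ in Filter.atTop, ∀ a ∈ I, ∀ c,
      t * coordDiff a c p + coordDiff a c y ≤ 0 := by
    rw [Filter.eventually_all_finset]
    intro a ha
    rw [Filter.eventually_all]
    exact key a ha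
  obtain ⟨t, ht, h⟩ := ((Filter.eventually_gt_atTop 0).and h2).exists
  refine ⟨t, ht.le, p + t⁻¹ • y, mem_hypCone_iff.2 fun a ha c => ?_, ?_⟩
  · have h3 := h a ha c
    rw [map_add, map_smul, smul_eq_mul]
    have : coordDiff a c p + t⁻¹ * coordDiff a c y =
        t⁻¹ * (t * coordDiff a c p + coordDiff a c y) := by
      field_simp
    rw [this]
    exact mul_nonpos_of_nonneg_of_nonpos (inv_pos.2 ht).le h3
  · rw [add_sub_cancel_left, smul_smul, mul_inv_cancel₀ ht.ne', one_smul]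

end Coordinates

/-! ### Edges -/

namespace Edge

variable {n : ℕ} (e : Edge n)

/-- The direction of an edge, as a real vector. -/
noncomputable def slope (c : Fin (n + 1)) : ℝ := e.dir c

theorem slope_nonneg (c : Fin (n + 1)) : 0 ≤ e.slope c := Nat.cast_nonneg _

theorem vec_eq : e.vec = proj n e.slope := rfl

@[simp]
theorem coordDiff_vec (a c : Fin (n + 1)) : coordDiff a c e.vec = e.slope a - e.slope c := by
  rw [vec_eq, coordDiff_proj]

theorem exists_slope_eq_zero : ∃ i, e.slope i = 0 := by
  obtain ⟨i, hi⟩ := e.dir_min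
  exact ⟨i, by simp [slope, hi]⟩

theorem exists_slope_ne : ∃ a c, e.slope a ≠ e.slope c := by
  obtain ⟨i, hi⟩ := e.dir_min
  by_contra! h
  have h0 : ∀ j ∈ Finset.univ, e.dir j = 0 := fun j _ => by
    have := h j i
    simpa [slope, hi] using this
  have := Finset.gcd_eq_zero_iff.2 h0
  rw [e.dir_primitive] at this
  exact one_ne_zero this

theorem injective_line : Function.Injective (fun s : ℝ => e.base + s • e.vec) := by
  obtain ⟨a, c, hac⟩ := e.exists_slope_ne
  intro s t hst
  have h := congrArg (coordDiff a c) (add_left_cancel hst)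
  simp only [map_smul, coordDiff_vec, smul_eq_mul] at h
  exact mul_right_cancel₀ (sub_ne_zero.2 hac) h

theorem eq_of_coordDiff_eq_zero {a c : Fin (n + 1)} (hac : e.slope a ≠ e.slope c) {s t : ℝ}
    (hs : coordDiff a c (e.base + s • e.vec) = 0) (ht : coordDiff a c (e.base + t • e.vec) = 0) :
    s = t := by
  simp only [map_add, map_smul, coordDiff_vec, smul_eq_mul] at hs ht
  exact mul_right_cancel₀ (sub_ne_zero.2 hac) (by linarith)

theorem base_mem_carrier : e.base ∈ e.carrier := ⟨0, le_rfl, by simp, by simp⟩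

theorem exists_pos_mem_carrier : ∃ s : ℝ, 0 < s ∧ ENNReal.ofReal s ≤ e.length := by
  obtain ⟨s, hs, hs'⟩ := ENNReal.lt_iff_exists_nnreal_btwn.1 (pos_iff_ne_zero.2 e.length_ne_zero)
  exact ⟨s, by simpa using hs, by simpa using hs'.le⟩

theorem vectorSpan_carrier : vectorSpan ℝ e.carrier = Submodule.span ℝ {e.vec} := by
  refine le_antisymm (Submodule.span_le.2 ?_) ?_
  · rintro _ ⟨_, ⟨s, -, -, rfl⟩, _, ⟨t, -, -, rfl⟩, rfl⟩
    refine Submodule.mem_span_singleton.2 ⟨s - t, ?_⟩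
    simp [sub_smul]
  · rw [Submodule.span_singleton_le_iff_mem]
    obtain ⟨s, hs, hs'⟩ := e.exists_pos_mem_carrier
    have h := vsub_mem_vectorSpan ℝ (show e.base + s • e.vec ∈ e.carrier from
      ⟨s, hs.le, hs', rfl⟩) e.base_mem_carrier
    have h2 := Submodule.smul_mem _ s⁻¹ h
    simpa [smul_smul, hs.ne'] using h2

theorem vec_mem_lattice : e.vec ∈ lattice n := ⟨fun i => e.dir i, by simp [vec]⟩

/-- The direction of an edge is a primitive lattice vector. -/
theorem exists_int_of_smul_vec_mem_lattice {s : ℝ} (h : s • e.vec ∈ lattice n) :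
    ∃ k : ℤ, s = k := by
  obtain ⟨z, hz⟩ := h
  rw [vec_eq, ← map_smul, proj_eq_proj_iff] at hz
  obtain ⟨r, hr⟩ := hz
  obtain ⟨i, hi⟩ := e.exists_slope_eq_zero
  -- An index `i` with zero entry determines the multiple of the all-ones vector, so every `s *
  -- e.dir j` is an integer; a Bézout relation between the entries then yields `s`.
  have hr' : ∀ j, s * e.dir j = ((z j - z i : ℤ) : ℝ) := by
    intro j
    have h1 := hr j
    have h2 := hr i
    simp only [Pi.smul_apply, hi, smul_eq_mul, mul_zero] at h1 h2
    push_cast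
    simp only [slope] at h1
    linarith
  have hgcd : Finset.univ.gcd (fun j => (e.dir j : ℤ)) = 1 := by
    have h1 : ((Finset.univ.gcd e.dir : ℕ) : ℤ) ∣ 1 := by simp [e.dir_primitive]
    have h2 : Finset.univ.gcd (fun j => (e.dir j : ℤ)) ∣ 1 := by
      have h3 : (Finset.univ.gcd (fun j => (e.dir j : ℤ))).natAbs ∣ Finset.univ.gcd e.dir :=
        Finset.dvd_gcd fun j hj => by
          have := Int.natAbs_dvd_natAbs.2
            (Finset.gcd_dvd (f := fun j => (e.dir j : ℤ)) hj)
          simpa using this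
      exact (Int.natAbs_dvd.1 (Int.natCast_dvd_natCast.2 h3)).trans h1
    have h4 := Finset.normalize_gcd (s := Finset.univ) (f := fun j => (e.dir j : ℤ))
    rw [← h4]
    exact normalize_eq_one.2 (isUnit_of_dvd_one h2)
  obtain ⟨g, hg⟩ := Finset.gcd_eq_sum_mul Finset.univ (fun j => (e.dir j : ℤ))
  rw [hgcd] at hg
  refine ⟨∑ j, (z j - z i) * g j, ?_⟩
  have hg' : (1 : ℝ) = ∑ j, (e.dir j : ℝ) * g j := by exact_mod_cast hg
  rw [← mul_one s, hg', Finset.mul_sum, Int.cast_sum]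
  refine Finset.sum_congr rfl fun j _ => ?_
  rw [Int.cast_mul, ← hr' j, mul_assoc]

/-- The functional `coordDiff a c` maps the lattice onto `ℤ` with kernel `N_τ`, and maps `N_σ`,
generated by the primitive vector, onto `dℤ`. The index is therefore that of `dℤ` in `ℤ`; for `d =
0` it is infinite, with value zero. -/
theorem latticeIndex_carrier_hypCone {a c : Fin (n + 1)} (hac : a ≠ c) :
    latticeIndex e.carrier (hypCone {a, c}) = ((e.dir a : ℤ) - e.dir c).natAbs := by
  set f : PT n →+ ℝ := (coordDiff a c).toAddMonoidHom with hf
  set d : ℤ := (e.dir a : ℤ) - e.dir c with hd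
  have hfv : f e.vec = (d : ℝ) := by simp [hf, hd, slope]
  have hlat : (lattice n).map f = (⊤ : AddSubgroup ℤ).map (Int.castAddHom ℝ) := by
    ext r
    constructor
    · rintro ⟨_, ⟨z, rfl⟩, rfl⟩
      exact ⟨z a - z c, trivial, by simp [hf]⟩
    · rintro ⟨k, -, rfl⟩
      refine ⟨k • proj n (Pi.single a 1), (lattice n).zsmul_mem ⟨Pi.single a 1, ?_⟩ k, ?_⟩
      · congr 1
        ext i
        by_cases hi : i = a
        · subst hi; simp
        · simp [hi]
      · rw [map_zsmul]
        simp [hf, coordDiff_single hac]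
  have hinf : (latticeOf e.carrier ⊔ latticeOf (hypCone {a, c})) ⊓ lattice n =
      ((AddSubgroup.zmultiples d).map (Int.castAddHom ℝ)).comap f ⊓ lattice n := by
    ext x
    simp only [AddSubgroup.mem_inf, and_congr_left_iff]
    intro hx
    constructor
    · intro h
      revert h
      suffices latticeOf e.carrier ⊔ latticeOf (hypCone {a, c}) ≤
          ((AddSubgroup.zmultiples d).map (Int.castAddHom ℝ)).comap f from fun h => this h
      refine sup_le ?_ ?_
      · rintro y ⟨hy, hy'⟩
        have hy2 : y ∈ vectorSpan ℝ e.carrier := hy'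
        rw [vectorSpan_carrier, Submodule.mem_span_singleton] at hy2
        obtain ⟨s, rfl⟩ := hy2
        obtain ⟨k, rfl⟩ := e.exists_int_of_smul_vec_mem_lattice hy
        refine ⟨k • d, AddSubgroup.zsmul_mem_zmultiples _ _, ?_⟩
        simp [hf, hd, slope]
      · rintro y ⟨-, hy'⟩
        have hy2 : y ∈ vectorSpan ℝ (hypCone {a, c}) := hy'
        rw [vectorSpan_hypCone_pair] at hy2
        have : f y = 0 := hy2
        rw [AddSubgroup.mem_comap, this]
        exact zero_mem _
    · rintro ⟨_, ⟨k, rfl⟩, hk⟩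
      have hk' : f x = k * (d : ℝ) := by simpa using hk.symm
      rw [← add_sub_cancel (k • e.vec) x]
      refine AddSubgroup.add_mem_sup ⟨(lattice n).zsmul_mem e.vec_mem_lattice k, ?_⟩
        ⟨(lattice n).sub_mem hx ((lattice n).zsmul_mem e.vec_mem_lattice k), ?_⟩
      · change k • e.vec ∈ vectorSpan ℝ e.carrier
        rw [vectorSpan_carrier]
        exact zsmul_mem (Submodule.mem_span_singleton_self _) k
      · change x - k • e.vec ∈ vectorSpan ℝ (hypCone {a, c})
        rw [vectorSpan_hypCone_pair, LinearMap.mem_ker]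
        change f (x - k • e.vec) = 0
        rw [map_sub, map_zsmul, hfv, hk']
        simp
  rw [latticeIndex, ← AddSubgroup.inf_relIndex_right, hinf, AddSubgroup.inf_relIndex_right,
    AddSubgroup.relIndex_comap, hlat, AddSubgroup.relIndex_map_map_of_injective _ _
      (by simpa using Int.cast_injective (α := ℝ)), AddSubgroup.relIndex_top_right,
    Int.index_zmultiples]

end Edge

/-! ### Slopes of an edge along the hyperplane -/

section Slopes

variable {n : ℕ}

/-- The smallest entry of `w` at the indices where the coordinates of `p` are minimal. -/
noncomputable def lowSlope (w : Fin (n + 1) → ℝ) (p : PT n) : ℝ :=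
  (minSet p).inf' (minSet_nonempty p) w

/-- The largest entry of `w` at the indices where the coordinates of `p` are minimal. -/
noncomputable def highSlope (w : Fin (n + 1) → ℝ) (p : PT n) : ℝ :=
  (minSet p).sup' (minSet_nonempty p) w

theorem lowSlope_le {w : Fin (n + 1) → ℝ} {p : PT n} {a : Fin (n + 1)} (ha : a ∈ minSet p) :
    lowSlope w p ≤ w a :=
  Finset.inf'_le _ ha

theorem le_highSlope {w : Fin (n + 1) → ℝ} {p : PT n} {a : Fin (n + 1)} (ha : a ∈ minSet p) :
    w a ≤ highSlope w p :=
  Finset.le_sup' _ ha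

theorem lowSlope_le_highSlope (w : Fin (n + 1) → ℝ) (p : PT n) :
    lowSlope w p ≤ highSlope w p := by
  obtain ⟨a, ha⟩ := minSet_nonempty p
  exact (lowSlope_le ha).trans (le_highSlope ha)

theorem exists_eq_lowSlope (w : Fin (n + 1) → ℝ) (p : PT n) :
    ∃ a ∈ minSet p, w a = lowSlope w p := by
  obtain ⟨a, ha, h⟩ := (minSet p).exists_mem_eq_inf' (minSet_nonempty p) w
  exact ⟨a, ha, h.symm⟩

theorem exists_eq_highSlope (w : Fin (n + 1) → ℝ) (p : PT n) :
    ∃ a ∈ minSet p, w a = highSlope w p := by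
  obtain ⟨a, ha, h⟩ := (minSet p).exists_mem_eq_sup' (minSet_nonempty p) w
  exact ⟨a, ha, h.symm⟩

end Slopes

namespace Edge

variable {n : ℕ} (e : Edge n)

/-- A point of an edge which is not a vertex. -/
def IsInterior (p : PT n) : Prop :=
  ∃ s : ℝ, 0 < s ∧ ENNReal.ofReal s < e.length ∧ p = e.base + s • e.vec

variable {e}

theorem ofReal_lt_length_iff (he : e.length ≠ ∞) {s : ℝ} :
    ENNReal.ofReal s < e.length ↔ s < e.length.toReal := by
  have := ENNReal.ofReal_lt_ofReal_iff (p := s) (ENNReal.toReal_pos e.length_ne_zero he)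
  rwa [ENNReal.ofReal_toReal he] at this

theorem IsEnd.mem_carrier {p : PT n} (h : e.IsEnd p) : p ∈ e.carrier :=
  ⟨e.length.toReal, ENNReal.toReal_nonneg, (ENNReal.ofReal_toReal h.1).le, h.2⟩

theorem IsInterior.mem_carrier {p : PT n} (h : e.IsInterior p) : p ∈ e.carrier := by
  obtain ⟨s, hs, hs', rfl⟩ := h
  exact ⟨s, hs.le, hs'.le, rfl⟩

theorem base_ne_of_isEnd {p : PT n} (h : e.IsEnd p) : e.base ≠ p := by
  intro hp
  have h0 : e.base + (0 : ℝ) • e.vec = e.base + e.length.toReal • e.vec := by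
    rw [← h.2, ← hp]; simp
  exact (ENNReal.toReal_pos e.length_ne_zero h.1).ne (e.injective_line h0)

theorem base_ne_of_isInterior {p : PT n} (h : e.IsInterior p) : e.base ≠ p := by
  obtain ⟨s, hs, -, rfl⟩ := h
  intro hp
  have h0 : e.base + (0 : ℝ) • e.vec = e.base + s • e.vec := by
    rw [← hp]; simp
  exact hs.ne (e.injective_line h0)

theorem IsInterior.not_isEnd {p : PT n} (h : e.IsInterior p) : ¬ e.IsEnd p := by
  obtain ⟨s, -, hs, rfl⟩ := h
  intro h'
  rw [ofReal_lt_length_iff h'.1] at hs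
  exact hs.ne (e.injective_line h'.2)

theorem smul_vec_mem_coneAt {s r t : ℝ} (hr : e.base + r • e.vec ∈ e.carrier) (hsr : s ≠ r)
    (ht : 0 ≤ t / (r - s)) : t • e.vec ∈ coneAt e.carrier (e.base + s • e.vec) := by
  refine ⟨t / (r - s), ht, _, hr, ?_⟩
  rw [add_sub_add_left_eq_sub, ← sub_smul, smul_smul,
    div_mul_cancel₀ _ (sub_ne_zero.2 hsr.symm)]

theorem smul_vec_mem_coneAt_base {t : ℝ} (ht : 0 ≤ t) :
    t • e.vec ∈ coneAt e.carrier e.base := by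
  obtain ⟨r, hr, hr'⟩ := e.exists_pos_mem_carrier
  have := smul_vec_mem_coneAt (e := e) (s := 0) (r := r) (t := t) ⟨r, hr.le, hr', rfl⟩ hr.ne
    (div_nonneg ht (by linarith))
  simpa using this

theorem IsEnd.smul_vec_mem_coneAt {p : PT n} (h : e.IsEnd p) {t : ℝ} (ht : t ≤ 0) :
    t • e.vec ∈ coneAt e.carrier p := by
  have hpos := ENNReal.toReal_pos e.length_ne_zero h.1
  have := Edge.smul_vec_mem_coneAt (e := e) (s := e.length.toReal) (r := 0) (t := t)
    (by simpa using e.base_mem_carrier) hpos.ne' (div_nonneg_of_nonpos ht (by linarith))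
  rwa [← h.2] at this

theorem IsInterior.smul_vec_mem_coneAt {p : PT n} (h : e.IsInterior p) (t : ℝ) :
    t • e.vec ∈ coneAt e.carrier p := by
  obtain ⟨s, hs, hs', rfl⟩ := h
  rcases le_total t 0 with ht | ht
  · exact Edge.smul_vec_mem_coneAt (r := 0) (by simpa using e.base_mem_carrier) hs.ne'
      (div_nonneg_of_nonpos ht (by linarith))
  · obtain ⟨r, hr, hr'⟩ := ENNReal.lt_iff_exists_nnreal_btwn.1 hs'
    have hsr : s < r := (ENNReal.ofReal_lt_coe_iff hs.le).1 hr
    exact Edge.smul_vec_mem_coneAt (r := r) ⟨r, by positivity, by simpa using hr'.le, rfl⟩ hsr.ne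
      (div_nonneg ht (by linarith))

/-! ### The local contribution of an edge -/

variable (e)

/-- The condition that the edge `e` and the cone of index `I` contribute at `p` to the stable
intersection, for the displacement `v`. -/
def Meets (v p : PT n) (I : Finset (Fin (n + 1))) : Prop :=
  p ∈ e.carrier ∧ p ∈ hypCone I ∧
    ∃ y ∈ coneAt e.carrier p, ∃ z ∈ coneAt (hypCone I) p, y = v + z

open Classical in
/-- The contribution of the edge `e`, taken with multiplicity one, at the point `p` to the stable
intersection with the standard tropical hyperplane. -/
noncomputable def localMult (v p : PT n) : ℕ :=
  ∑ I ∈ (Finset.univ : Finset (Fin (n + 1))).powersetCard 2,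
    if e.Meets v p I then latticeIndex e.carrier (hypCone I) else 0

theorem slope_sub_le_latticeIndex {a c : Fin (n + 1)} (hac : a ≠ c) :
    e.slope c - e.slope a ≤ latticeIndex e.carrier (hypCone {a, c}) := by
  rw [e.latticeIndex_carrier_hypCone hac]
  have h : (e.dir c : ℤ) - e.dir a ≤ (((e.dir a : ℤ) - e.dir c).natAbs : ℤ) := by omega
  have h' : (((e.dir c : ℤ) - e.dir a : ℤ) : ℝ) ≤ ((((e.dir a : ℤ) - e.dir c).natAbs : ℤ) : ℝ) :=
    Int.cast_le.2 h
  simpa only [slope, Int.cast_sub, Int.cast_natCast] using h'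

variable {e}

/-- Near `p` only the coordinates in `minSet p` compete. At the point `t • e.vec - v` they are the
affine functions `-V i + t * e.slope i`, so two of them being lowest means that this point lies in
the star cone of the pair. -/
theorem meets_pair {V : Fin (n + 1) → ℝ} {p : PT n} (hp : p ∈ e.carrier) {t : ℝ}
    (ht : t • e.vec ∈ coneAt e.carrier p) {a c : Fin (n + 1)}
    (ha : IsLow (minSet p) (-V) e.slope t a) (hc : IsLow (minSet p) (-V) e.slope t c) :
    e.Meets (proj n V) p {a, c} := by
  have hp' : p ∈ hypCone {a, c} := by
    rw [mem_hypCone_iff_subset]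
    intro i hi
    rcases Finset.mem_insert.1 hi with rfl | hi
    · exact ha.1
    · obtain rfl := Finset.mem_singleton.1 hi
      exact hc.1
  refine ⟨hp, hp', t • e.vec, ht, t • e.vec - proj n V, ?_, by abel⟩
  refine mem_coneAt_hypCone hp' fun i hi j hj => ?_
  have key : ∀ i, IsLow (minSet p) (-V) e.slope t i →
      coordDiff i j (t • e.vec - proj n V) ≤ 0 := by
    intro i hi
    have := hi.2 j hj
    simp only [Pi.neg_apply] at this
    simp only [map_sub, map_smul, coordDiff_vec, coordDiff_proj, smul_eq_mul]
    linarith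
  rcases Finset.mem_insert.1 hi with rfl | hi
  · exact key _ ha
  · obtain rfl := Finset.mem_singleton.1 hi
    exact key _ hc

theorem slope_drop_le_localMult {V : Fin (n + 1) → ℝ} {p : PT n} (hp : p ∈ e.carrier)
    {s S : ℝ} (hsS : s < S) (hcone : ∀ t, s < t → t < S → t • e.vec ∈ coneAt e.carrier p)
    {c d : Fin (n + 1)} (hc : IsLow (minSet p) (-V) e.slope s c)
    (hmin : ∀ i, IsLow (minSet p) (-V) e.slope s i → e.slope c ≤ e.slope i)
    (hd : IsLow (minSet p) (-V) e.slope S d)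
    (hmax : ∀ i, IsLow (minSet p) (-V) e.slope S i → e.slope i ≤ e.slope d) :
    e.slope c - e.slope d ≤ e.localMult (proj n V) p := by
  classical
  have := slope_drop_le_sum_pairs (ω := fun I => (latticeIndex e.carrier (hypCone I) : ℝ))
    (fun I => Nat.cast_nonneg _) (fun a c hac => e.slope_sub_le_latticeIndex hac)
    (C := e.Meets (proj n V) p)
    (fun t h1 h2 a c _ ha hc => meets_pair hp (hcone t h1 h2) ha hc) hsS hc hmin hd hmax
  rw [localMult]
  push_cast
  convert this using 2

open Classical in
/-- The slope drop along an edge at `p`, measured from the index `c` selected by the generic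
displacement. -/
noncomputable def slopeDrop (e : Edge n) (c : Fin (n + 1)) (p : PT n) : ℝ :=
  (if e.base = p then e.slope c - lowSlope e.slope p else 0) +
    (if e.IsEnd p then highSlope e.slope p - e.slope c else 0) +
    if e.IsInterior p then highSlope e.slope p - lowSlope e.slope p else 0

/-- As `V` is strictly largest at `c`, the envelope has slope `e.slope c` at parameter zero. Its
slope is `highSlope` far to the left and `lowSlope` far to the right. The star of the edge at `p`
covers the parameters `t ≥ 0` at the base, `t ≤ 0` at the end and all `t` at an interior point,
which gives the three cases. -/
theorem slopeDrop_le_localMult {V : Fin (n + 1) → ℝ} {p : PT n} {c : Fin (n + 1)}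
    (hc : c ∈ minSet p) (hV : ∀ a ∈ minSet p, a ≠ c → V a < V c) :
    e.slopeDrop c p ≤ e.localMult (proj n V) p := by
  classical
  have hlow : IsLow (minSet p) (-V) e.slope 0 c := by
    refine ⟨hc, fun i hi => ?_⟩
    rcases eq_or_ne i c with rfl | hne
    · exact le_rfl
    · have := hV i hi hne
      simp only [Pi.neg_apply]
      linarith
  have huniq : ∀ i, IsLow (minSet p) (-V) e.slope 0 i → i = c := by
    intro i hi
    by_contra hne
    have h1 := hV i hi.1 hne
    have h2 := hi.2 c hc
    simp only [Pi.neg_apply] at h2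
    linarith
  obtain ⟨S, hS, hSlow⟩ := exists_isLow_right (minSet p) (-V) e.slope 0
  obtain ⟨s, hs, hsHigh⟩ := exists_isLow_left (minSet p) (-V) e.slope 0
  obtain ⟨d, hd⟩ := exists_isLow (minSet_nonempty p) (-V) e.slope S
  obtain ⟨u, hu⟩ := exists_isLow (minSet_nonempty p) (-V) e.slope s
  have hdlow : e.slope d ≤ lowSlope e.slope p := by
    obtain ⟨a, ha, h⟩ := exists_eq_lowSlope e.slope p
    exact h ▸ hSlow d hd a ha
  have huhigh : highSlope e.slope p ≤ e.slope u := by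
    obtain ⟨a, ha, h⟩ := exists_eq_highSlope e.slope p
    exact h ▸ hsHigh u hu a ha
  have hmin0 : ∀ i, IsLow (minSet p) (-V) e.slope 0 i → e.slope c ≤ e.slope i :=
    fun i hi => by rw [huniq i hi]
  have hmax0 : ∀ i, IsLow (minSet p) (-V) e.slope 0 i → e.slope i ≤ e.slope c :=
    fun i hi => by rw [huniq i hi]
  have hminS : ∀ i, IsLow (minSet p) (-V) e.slope s i → e.slope u ≤ e.slope i :=
    fun i hi => hsHigh i hi u hu.1
  have hmaxS : ∀ i, IsLow (minSet p) (-V) e.slope S i → e.slope i ≤ e.slope d :=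
    fun i hi => hSlow i hi d hd.1
  rw [slopeDrop]
  by_cases h1 : e.base = p
  · have h2 : ¬ e.IsEnd p := fun h => base_ne_of_isEnd h h1
    have h3 : ¬ e.IsInterior p := fun h => base_ne_of_isInterior h h1
    rw [if_pos h1, if_neg h2, if_neg h3]
    have := slope_drop_le_localMult (h1 ▸ e.base_mem_carrier) hS
      (fun t ht _ => h1 ▸ smul_vec_mem_coneAt_base ht.le) hlow hmin0 hd hmaxS
    linarith
  by_cases h2 : e.IsEnd p
  · have h3 : ¬ e.IsInterior p := fun h => h.not_isEnd h2
    rw [if_neg h1, if_pos h2, if_neg h3]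
    have := slope_drop_le_localMult h2.mem_carrier hs
      (fun t _ ht => h2.smul_vec_mem_coneAt ht.le) hu hminS hlow hmax0
    linarith
  by_cases h3 : e.IsInterior p
  · rw [if_neg h1, if_neg h2, if_pos h3]
    have := slope_drop_le_localMult h3.mem_carrier (hs.trans hS)
      (fun t _ _ => h3.smul_vec_mem_coneAt t) hu hminS hd hmaxS
    linarith
  · rw [if_neg h1, if_neg h2, if_neg h3]
    simp

/-! ### Telescoping along an edge -/

theorem isLow_univ_iff {B : Fin (n + 1) → ℝ} (hB : proj n B = e.base) {s : ℝ}
    {a : Fin (n + 1)} :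
    IsLow Finset.univ B e.slope s a ↔ a ∈ minSet (e.base + s • e.vec) := by
  rw [← hB, vec_eq, ← map_smul, ← map_add, mem_minSet_proj_iff]
  simp [IsLow]

-- Between the base and the point at parameter `S`, the slope of the minimum of the coordinates
-- drops only at interior points where two coordinates of different slopes agree, all of which lie
-- in `P`.
open Classical in
theorem lowSlope_base_le_add_sum {P : Finset (PT n)}
    (hP : ∀ s : ℝ, 0 < s → ENNReal.ofReal s < e.length → ∀ a c, e.slope a ≠ e.slope c →
      coordDiff a c (e.base + s • e.vec) = 0 → e.base + s • e.vec ∈ P)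
    {S : ℝ} (hS : 0 < S) (hlen : ∀ t, t < S → ENNReal.ofReal t < e.length) :
    lowSlope e.slope e.base ≤ highSlope e.slope (e.base + S • e.vec) +
      ∑ p ∈ P, if e.IsInterior p then highSlope e.slope p - lowSlope e.slope p else 0 := by
  obtain ⟨B, hB⟩ := proj_surjective e.base
  obtain ⟨c, hc, hcl⟩ := exists_eq_lowSlope e.slope e.base
  obtain ⟨d, hd, hdh⟩ := exists_eq_highSlope e.slope (e.base + S • e.vec)
  have hbase : ∀ i, IsLow Finset.univ B e.slope 0 i ↔ i ∈ minSet e.base := by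
    intro i
    rw [isLow_univ_iff hB]
    simp
  have hdrop : ∀ p, 0 ≤ highSlope e.slope p - lowSlope e.slope p :=
    fun p => sub_nonneg.2 (lowSlope_le_highSlope _ p)
  have key := slope_drop_le_sum (J := Finset.univ) (b := B) (w := e.slope) (S := S) P
    (fun p => highSlope e.slope p - lowSlope e.slope p)
    (fun p t => p = e.base + t • e.vec) (fun p _ => hdrop p)
    ((isLow_univ_iff hB).2 hd)
    (fun i hi => hdh ▸ le_highSlope ((isLow_univ_iff hB).1 hi)) hS ((hbase c).2 hc)
    (fun i hi => hcl ▸ lowSlope_le ((hbase i).1 hi))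
    (by
      intro t c₀ c₁ ht htS h0 h1 hlt
      refine ⟨e.base + t • e.vec, hP t ht (hlen t htS) c₀ c₁ hlt.ne' ?_, rfl,
        fun t' h => (e.injective_line h).symm, ?_⟩
      · have e1 := h0.2 c₁ (Finset.mem_univ _)
        have e2 := h1.2 c₀ (Finset.mem_univ _)
        rw [← hB, vec_eq, ← map_smul, ← map_add, coordDiff_proj]
        simp only [Pi.add_apply, Pi.smul_apply, smul_eq_mul]
        linarith
      · exact sub_le_sub (le_highSlope ((isLow_univ_iff hB).1 h0))
          (lowSlope_le ((isLow_univ_iff hB).1 h1)))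
  have hsum : ∑ p ∈ P, (if ∃ t, 0 < t ∧ t < S ∧ p = e.base + t • e.vec then
        highSlope e.slope p - lowSlope e.slope p else 0) ≤
      ∑ p ∈ P, if e.IsInterior p then highSlope e.slope p - lowSlope e.slope p else 0 := by
    refine Finset.sum_le_sum fun p _ => ?_
    by_cases h : ∃ t, 0 < t ∧ t < S ∧ p = e.base + t • e.vec
    · have h' : e.IsInterior p := by
        obtain ⟨t, h1, h2, h3⟩ := h
        exact ⟨t, h1, hlen t h2, h3⟩
      rw [if_pos h, if_pos h']
    · rw [if_neg h]
      split_ifs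
      exacts [hdrop p, le_rfl]
  linarith

open Classical in
/-- Sum of the slope drops along an edge, relative to the slope of a fixed coordinate. -/
theorem le_sum_slopeDrop {P : Finset (PT n)} (hbase : e.base ∈ P)
    (hend : ∀ p, e.IsEnd p → p ∈ P)
    (hP : ∀ s : ℝ, 0 < s → ENNReal.ofReal s < e.length → ∀ a c, e.slope a ≠ e.slope c →
      coordDiff a c (e.base + s • e.vec) = 0 → e.base + s • e.vec ∈ P) (c : Fin (n + 1)) :
    (if e.length = ∞ then e.slope c else 0) ≤ ∑ p ∈ P, e.slopeDrop c p := by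
  simp only [slopeDrop, Finset.sum_add_distrib]
  rw [Finset.sum_ite_eq P e.base, if_pos hbase]
  by_cases h : e.length = ∞
  · have hnot : ∀ p, ¬ e.IsEnd p := fun p hp => hp.1 h
    simp only [h, if_true, hnot, if_false, Finset.sum_const_zero]
    obtain ⟨B, hB⟩ := proj_surjective e.base
    obtain ⟨S, hS, hlow⟩ := exists_isLow_right Finset.univ B e.slope 0
    have key := lowSlope_base_le_add_sum hP hS (fun t _ => h ▸ ENNReal.ofReal_lt_top)
    obtain ⟨d, hd, hdh⟩ := exists_eq_highSlope e.slope (e.base + S • e.vec)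
    obtain ⟨i, hi⟩ := e.exists_slope_eq_zero
    -- Far out on a ray the minimum has the smallest slope, which is zero.
    have := hlow d ((isLow_univ_iff hB).2 hd) i (Finset.mem_univ i)
    linarith
  · have hE : e.IsEnd (e.base + e.length.toReal • e.vec) := ⟨h, rfl⟩
    have hiff : ∀ p, e.IsEnd p ↔ e.base + e.length.toReal • e.vec = p :=
      fun p => ⟨fun hp => hp.2.symm, fun hp => hp ▸ hE⟩
    simp only [hiff, Finset.sum_ite_eq, if_pos (hend _ hE), if_neg h]
    have key := lowSlope_base_le_add_sum hP (ENNReal.toReal_pos e.length_ne_zero h)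
      (fun t ht => (ofReal_lt_length_iff h).2 ht)
    -- The terms `e.slope c` from the two endpoints cancel.
    linarith

end Edge

/-! ### The degree in terms of the rays -/

namespace TropicalCurve

variable {n : ℕ} (Γ : TropicalCurve n)

/-- The vertices of the curve, and the points of its edges at which two coordinates of different
slopes agree. -/
def breakpoints : Set (PT n) :=
  ⋃ i, (Γ.edge i).endpoints ∪
    ⋃ a, ⋃ c, {p | p ∈ (Γ.edge i).carrier ∧ (Γ.edge i).slope a ≠ (Γ.edge i).slope c ∧
      coordDiff a c p = 0}

theorem finite_breakpoints : Γ.breakpoints.Finite := by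
  refine Set.finite_iUnion fun i => Set.Finite.union ?_ ?_
  · refine (Set.toFinite {(Γ.edge i).base,
      (Γ.edge i).base + (Γ.edge i).length.toReal • (Γ.edge i).vec}).subset ?_
    rintro p (h | h)
    · exact Or.inl h
    · exact Or.inr h.2
  · refine Set.finite_iUnion fun a => Set.finite_iUnion fun c => Set.Subsingleton.finite ?_
    rintro _ ⟨⟨s, -, -, rfl⟩, hne, hs⟩ _ ⟨⟨t, -, -, rfl⟩, -, ht⟩
    rw [(Γ.edge i).eq_of_coordDiff_eq_zero hne hs ht]

theorem multAt_eq (v p : PT n) :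
    Γ.multAt v p = ∑ i, Γ.mult i * (Γ.edge i).localMult v p := by
  classical
  refine Finset.sum_congr rfl fun i _ => ?_
  rw [Edge.localMult, Finset.mul_sum]
  refine Finset.sum_congr rfl fun I _ => ?_
  by_cases h : (Γ.edge i).Meets v p I
  · exact (if_pos h).trans (by rw [if_pos h])
  · exact (if_neg h).trans (by rw [if_neg h, mul_zero])

/-- A pair of coordinates with equal slopes has lattice index zero, so only pairs of different
slopes contribute, and each does so at one point of the edge at most. This makes the degree a finite
sum. -/
theorem mem_breakpoints_of_multAt_ne_zero {v p : PT n} (h : Γ.multAt v p ≠ 0) :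
    p ∈ Γ.breakpoints := by
  classical
  rw [multAt_eq] at h
  obtain ⟨i, -, hi⟩ := Finset.exists_ne_zero_of_sum_ne_zero h
  obtain ⟨I, hI, hIne⟩ := Finset.exists_ne_zero_of_sum_ne_zero (right_ne_zero_of_mul hi)
  obtain ⟨hmeet, hidx⟩ := ite_ne_right_iff.1 hIne
  obtain ⟨a, c, hac, rfl⟩ := Finset.card_eq_two.1 (Finset.mem_powersetCard.1 hI).2
  rw [Edge.latticeIndex_carrier_hypCone _ hac] at hidx
  refine Set.mem_iUnion.2 ⟨i, Or.inr (Set.mem_iUnion.2 ⟨a, Set.mem_iUnion.2 ⟨c, hmeet.1, ?_,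
    coordDiff_eq_zero_of_mem_hypCone hmeet.2.1⟩⟩)⟩
  intro heq
  refine hidx ?_
  have : (Γ.edge i).dir a = (Γ.edge i).dir c := Nat.cast_injective heq
  simp [this]

theorem degree_eq_sum : Γ.degree = ∑ p ∈ Γ.finite_breakpoints.toFinset, Γ.stableMult p :=
  finsum_eq_sum_of_support_subset _ fun p hp => by
    rw [Set.Finite.coe_toFinset]
    exact Γ.mem_breakpoints_of_multAt_ne_zero hp

open Classical in
/-- The balancing condition, in coordinates. -/
theorem balanced_coord (p : PT n) (a c : Fin (n + 1)) :
    ∑ i, (Γ.mult i : ℝ) * ((if (Γ.edge i).base = p then (Γ.edge i).slope a - (Γ.edge i).slope c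
      else 0) - if (Γ.edge i).IsEnd p then (Γ.edge i).slope a - (Γ.edge i).slope c else 0) = 0 := by
  have h := congrArg (coordDiff a c) (Γ.balanced p)
  rw [map_add, map_sum, map_sum, ← Finset.sum_add_distrib, map_zero] at h
  refine (Finset.sum_congr rfl fun i _ => ?_).trans h
  split_ifs <;> simp [mul_sub]

/-- The local estimate requires an index depending on `p`, the telescoping a single index for the
whole curve; balancing at `p` permits the exchange, because the two sums differ by `coordDiff a c`
of the balancing relation. -/
theorem sum_slopeDrop_eq (p : PT n) (a c : Fin (n + 1)) :
    ∑ i, (Γ.mult i : ℝ) * (Γ.edge i).slopeDrop a p =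
      ∑ i, (Γ.mult i : ℝ) * (Γ.edge i).slopeDrop c p := by
  classical
  rw [← sub_eq_zero, ← Finset.sum_sub_distrib, ← Γ.balanced_coord p a c]
  refine Finset.sum_congr rfl fun i _ => ?_
  rw [← mul_sub, Edge.slopeDrop, Edge.slopeDrop]
  congr 1
  split_ifs <;> ring

theorem sum_slopeDrop_le_multAt {v : PT n} (hv : Γ.IsGeneric v) (p : PT n) (c : Fin (n + 1)) :
    ∑ i, (Γ.mult i : ℝ) * (Γ.edge i).slopeDrop c p ≤ Γ.multAt v p := by
  obtain ⟨V, rfl⟩ := proj_surjective v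
  -- Genericity of the displacement makes this maximum strict, as `slopeDrop_le_localMult` demands.
  obtain ⟨d, hd, hmax⟩ := (minSet p).exists_max_image V (minSet_nonempty p)
  rw [Γ.sum_slopeDrop_eq p c d, multAt_eq]
  push_cast
  refine Finset.sum_le_sum fun i _ => mul_le_mul_of_nonneg_left ?_ (Nat.cast_nonneg _)
  refine Edge.slopeDrop_le_localMult hd fun a ha hne => lt_of_le_of_ne (hmax a ha) fun h => ?_
  exact hv.coordDiff_ne_zero hne (by rw [coordDiff_proj, h, sub_self])

open Classical in
/-- The degree is at least the weighted sum, over the rays, of the `c`-th coordinates of their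
primitive directions. -/
theorem sum_rays_le_degree (c : Fin (n + 1)) :
    ∑ i, (Γ.mult i : ℝ) * (if (Γ.edge i).length = ∞ then (Γ.edge i).slope c else 0) ≤
      Γ.degree := by
  rw [degree_eq_sum]
  push_cast
  refine le_trans ?_ (Finset.sum_le_sum fun p _ =>
    Γ.sum_slopeDrop_le_multAt Γ.exists_isGeneric.choose_spec p c)
  rw [Finset.sum_comm]
  refine Finset.sum_le_sum fun i _ => ?_
  rw [← Finset.mul_sum]
  refine mul_le_mul_of_nonneg_left (Edge.le_sum_slopeDrop ?_ ?_ ?_ c) (Nat.cast_nonneg _)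
  · exact (Set.Finite.mem_toFinset _).2 (Set.mem_iUnion.2 ⟨i, Or.inl (Or.inl rfl)⟩)
  · intro p hp
    exact (Set.Finite.mem_toFinset _).2 (Set.mem_iUnion.2 ⟨i, Or.inl (Or.inr hp)⟩)
  · intro s hs hs' a b hab h0
    exact (Set.Finite.mem_toFinset _).2 (Set.mem_iUnion.2 ⟨i, Or.inr (Set.mem_iUnion.2
      ⟨a, Set.mem_iUnion.2 ⟨b, ⟨s, hs.le, hs'.le, rfl⟩, hab, h0⟩⟩)⟩)

/-- All terms of the sum over the rays are nonnegative, and multiplicities are at least one. -/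
theorem dir_le_degree {i : Fin Γ.numEdges} (hi : (Γ.edge i).length = ∞) (c : Fin (n + 1)) :
    (Γ.edge i).dir c ≤ Γ.degree := by
  classical
  have h1 : (Γ.mult i : ℝ) * (if (Γ.edge i).length = ∞ then (Γ.edge i).slope c else 0) ≤
      Γ.degree := by
    refine le_trans (Finset.single_le_sum (f := fun j => (Γ.mult j : ℝ) *
      (if (Γ.edge j).length = ∞ then (Γ.edge j).slope c else 0)) (fun j _ => ?_)
      (Finset.mem_univ i)) (Γ.sum_rays_le_degree c)
    refine mul_nonneg (Nat.cast_nonneg _) ?_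
    split_ifs
    exacts [(Γ.edge j).slope_nonneg c, le_rfl]
  rw [if_pos hi, Edge.slope] at h1
  have h2 : Γ.mult i * (Γ.edge i).dir c ≤ Γ.degree := by exact_mod_cast h1
  exact (Nat.le_mul_of_pos_left _ (Γ.mult_pos i)).trans h2

end TropicalCurve

/-! ### The tropical convex hull of an edge -/

section Dimension

variable {n : ℕ}

theorem dim_le_finrank {S : Set (PT n)} (x : PT n) (W : Submodule ℝ (PT n))
    (h : ∀ y ∈ S, y - x ∈ W) : dim S ≤ Module.finrank ℝ W := by
  refine csSup_le' ?_
  rintro _ ⟨P, -, hPS, rfl⟩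
  refine Submodule.finrank_mono (Submodule.span_le.2 ?_)
  rintro _ ⟨y, hy, z, hz, rfl⟩
  have := W.sub_mem (h y (hPS hy)) (h z (hPS hz))
  simpa using this

/-- The linear map sending `g` to the class of the vector with entries `g (w j)`, where
`g 0 = 0`. -/
noncomputable def pullback (w : Fin (n + 1) → ℕ) (M : ℕ) : (Fin M → ℝ) →ₗ[ℝ] PT n :=
  proj n ∘ₗ LinearMap.pi fun j =>
    if h : w j - 1 < M ∧ w j ≠ 0 then LinearMap.proj (R := ℝ) (φ := fun _ => ℝ) ⟨w j - 1, h.1⟩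
    else 0

theorem proj_comp_mem_range_pullback {w : Fin (n + 1) → ℕ} {M : ℕ} (hw : ∀ j, w j ≤ M)
    (g : ℕ → ℝ) : proj n (fun j => g (w j)) ∈ (pullback w M).range := by
  -- Subtracting `g 0` is a translation by a multiple of the all-ones vector; the slots `0, …, M -
  -- 1` hold the values for slopes `1, …, M`.
  refine ⟨fun k => g (k + 1) - g 0, ?_⟩
  rw [pullback, LinearMap.comp_apply, proj_eq_proj_iff]
  refine ⟨-g 0, fun j => ?_⟩
  rw [LinearMap.pi_apply]
  by_cases h0 : w j = 0
  · simp [h0]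
  · have h1 : w j - 1 < M := by have := hw j; omega
    have h2 : w j - 1 + 1 = w j := by omega
    simp [h0, h1, h2, sub_eq_add_neg]

theorem Edge.dim_tconv_carrier_le (e : Edge n) {M : ℕ} (hM : ∀ c, e.dir c ≤ M) :
    dim (tconv e.carrier) ≤ M := by
  refine (dim_le_finrank e.base (pullback e.dir M).range ?_).trans
    ((LinearMap.finrank_range_le _).trans (by simp))
  rintro _ ⟨k, u, a, hu, rfl⟩
  obtain ⟨B, hB⟩ := proj_surjective e.base
  choose s _ _ hs using hu
  have hs' : ∀ i, ∃ r : ℝ, ∀ j, u i j = B j + s i * e.dir j + r := by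
    intro i
    have h := hs i
    rw [← hB, Edge.vec, ← map_smul, ← map_add, proj_eq_proj_iff] at h
    simpa using h
  choose r hr using hs'
  rw [← hB, ← map_sub]
  -- After subtraction of the base point, a tropical combination depends on `j` only through `e.dir
  -- j`.
  have : (fun j => Finset.univ.inf' Finset.univ_nonempty (fun i => a i + u i j)) - B =
      fun j => (fun m : ℕ => Finset.univ.inf' Finset.univ_nonempty
        (fun i => a i + (s i * m + r i))) (e.dir j) := by
    ext j
    rw [Pi.sub_apply]
    refine (Finset.apply_inf'_eq_inf'_comp Finset.univ_nonempty (fun x : ℝ => x - B j)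
      fun x y => (min_sub_sub_right x y _).symm).trans ?_
    refine Finset.inf'_congr _ rfl fun i _ => ?_
    simp only [Function.comp_apply, hr]
    ring
  rw [this]
  exact proj_comp_mem_range_pullback hM
    (fun m : ℕ => Finset.univ.inf' Finset.univ_nonempty (fun i => a i + (s i * m + r i)))

end Dimension

end TropCurve

theorem mainTheorem12 (n : ℕ) (Γ : TropCurve.TropicalCurve n)
    (h : IsGreatest ((fun r => TropCurve.dim (TropCurve.tconv r)) '' Γ.rays)
      (TropCurve.dim (TropCurve.tconv Γ.support))) :
    TropCurve.dim (TropCurve.tconv Γ.support) ≤ Γ.degree := by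
  obtain ⟨_, ⟨i, hi, rfl⟩, hdim⟩ := h.1
  rw [← hdim]
  exact (Γ.edge i).dim_tconv_carrier_le (Γ.dir_le_degree hi)
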